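/- Let $\mathbb{K}$ be $\mathbb{R}$ or $\mathbb{C}$. For a form $F\in\mathbb{K}[x_0,\ldots,x_n]$ of degree $d$, the Waring rank $\mathrm{rk}_{\mathbb{K}}(F)$ is the smallest $s$ for which there exist scalars $c_1,\ldots,c_s\in\mathbb{K}$ and linear forms $L_1,\ldots,L_s$ over $\mathbb{K}$ with $F=\sum_{i=1}^s c_iL_i^d$. Theorem. Let $n\ge 1$ and let $M=x_0^{a_0}\cdots x_n^{a_n}$ be a monomial of degree $d=a_0+\cdots+a_n$ with $0<a_0\le a_1\le\cdots\le a_n$. Then $$\mathrm{rk}_{\mathbb{R}}(M)=\mathrm{rk}_{\mathbb{C}}(M)$$ if and only if $a_0=1$. -/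

import Mathlib

open MvPolynomial

/-- `F` has a Waring decomposition over `K` with `s` summands in degree `d`:
`F = ∑ c_i L_i ^ d` with scalars `c_i ∈ K` and linear forms `L_i` over `K`. -/
def HasWaringDecomposition (K : Type*) [Field K] {σ : Type*} (d : ℕ) (F : MvPolynomial σ K)
    (s : ℕ) : Prop :=
  ∃ (c : Fin s → K) (L : Fin s → MvPolynomial σ K),
    (∀ i, (L i).IsHomogeneous 1) ∧ F = ∑ i, C (c i) * L i ^ d

/-- The Waring rank over `K` of a form `F` of degree `d`: the smallest number of summands in a
Waring decomposition of `F` over `K` (and `⊤` if there is no decomposition at all). -/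
noncomputable def waringRank (K : Type*) [Field K] {σ : Type*} (d : ℕ) (F : MvPolynomial σ K) :
    ℕ∞ :=
  ⨅ (s : ℕ) (_ : HasWaringDecomposition K d F s), (s : ℕ∞)

/-! Comparing coefficients turns a Waring decomposition of M into a quadrature rule: a weighted sum
over nodes that extracts the coefficient of x^a from forms of degree d. Setting x_0 = 1 gives an
affine rule for a' = (a_1, ..., a_n).

Lower bound: the monomials x^b with b ≤ a' are linearly independent on the nodes with x_0 ≠ 0, so
there are at least ∏_{i≥1} (a_i + 1) nodes. Over ℂ, grids of roots of unity attain this.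

If a_0 ≥ 2 and the bound is attained, these monomials form a basis of the functions on the nodes. In
this basis multiplication by x_k^2 has zero diagonal, so its trace, the sum of the squares of the
k-th coordinates, is 0. Over ℝ all these coordinates then vanish, contradicting independence. If a_0
= 1, grids of real nodes with sum zero in each coordinate suffice. -/

/-- The weights `c` and nodes `q` compute the coefficient of `x ^ a` of every polynomial of
degree at most `D`. -/
def ComputesCoeff {K ι τ : Type*} [Field K] [Fintype ι] [Fintype τ] (c : ι → K) (q : ι → τ → K)
    (a : τ → ℕ) (D : ℕ) : Prop :=
  ∀ β : τ → ℕ, ∑ i, β i ≤ D → ∑ j, c j * ∏ i, q j i ^ β i = Set.indicator {a} 1 β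

/-! ### Waring decompositions as moment conditions -/

theorem MvPolynomial.IsHomogeneous.eq_sum_smul_X {K σ : Type*} [Field K] [Fintype σ]
    {L : MvPolynomial σ K} (hL : L.IsHomogeneous 1) : ∃ p : σ → K, L = ∑ i, p i • X i := by
  have h : L ∈ Submodule.span K (Set.range (X : σ → MvPolynomial σ K)) := by
    rw [← homogeneousSubmodule_one_eq_span_X]
    exact hL
  obtain ⟨p, hp⟩ := (Submodule.mem_span_range_iff_exists_fun K).1 h
  exact ⟨p, hp.symm⟩

theorem coeff_pow_linearForm {K σ : Type*} [Field K] [Fintype σ] (p : σ → K) (β : σ →₀ ℕ)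
    (d : ℕ) : coeff β ((∑ i, p i • X i : MvPolynomial σ K) ^ d) =
      if ∑ i, β i = d then (β.multinomial : K) * ∏ i, p i ^ β i else 0 := by
  rw [coeff_linearCombination_X_pow_of_fintype, Finsupp.sum_fintype _ _ (fun _ => rfl),
    Finsupp.prod_fintype _ _ (fun _ => pow_zero _)]

/-- Multinomial coefficients are nonzero in characteristic zero; the one of `a` is absorbed into the
weights, the others multiply zero. -/
theorem hasWaringDecomposition_monomial_iff {K σ : Type*} [Field K] [CharZero K] [Fintype σ]
    (a : σ → ℕ) (d : ℕ) (hd : d = ∑ i, a i) (s : ℕ) :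
    HasWaringDecomposition K d (∏ i, (X i : MvPolynomial σ K) ^ a i) s ↔
      ∃ (c : Fin s → K) (p : Fin s → σ → K), ∀ β : σ → ℕ, ∑ i, β i = d →
        ∑ j, c j * ∏ i, p j i ^ β i = Set.indicator {a} 1 β := by
  classical
  have hM : ∏ i, (X i : MvPolynomial σ K) ^ a i = monomial (Finsupp.equivFunOnFinite.symm a) 1 := by
    rw [monomial_eq, Finsupp.prod_fintype _ _ (fun _ => pow_zero _)]
    simp
  have hne (β : σ →₀ ℕ) : (β.multinomial : K) ≠ 0 := by
    rw [Finsupp.multinomial_eq]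
    exact_mod_cast (Nat.multinomial_pos _ _).ne'
  rw [hM]
  constructor
  · rintro ⟨c, L, hL, hF⟩
    choose p hp using fun j => (hL j).eq_sum_smul_X
    refine ⟨fun j => (Finsupp.equivFunOnFinite.symm a).multinomial * c j, p, fun β hβ => ?_⟩
    have h := congrArg (coeff (Finsupp.equivFunOnFinite.symm β)) hF
    simp only [coeff_monomial, coeff_sum, coeff_C_mul, hp, coeff_pow_linearForm,
      Finsupp.equivFunOnFinite_symm_apply_apply, hβ, if_true] at h
    by_cases hab : β = a
    · subst hab
      simp only [if_true] at h
      simp only [Set.indicator_of_mem (Set.mem_singleton β), Pi.one_apply]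
      rw [h]
      exact Finset.sum_congr rfl fun j _ => by ring
    · have hab' : Finsupp.equivFunOnFinite.symm a ≠ Finsupp.equivFunOnFinite.symm β := fun h' =>
        hab (Finsupp.equivFunOnFinite.symm.injective h').symm
      rw [if_neg hab'] at h
      rw [Set.indicator_of_notMem (by simpa using hab)]
      have h2 : ((Finsupp.equivFunOnFinite.symm β).multinomial : K) *
          ∑ j, c j * ∏ i, p j i ^ β i = 0 := by
        rw [h, Finset.mul_sum]
        exact Finset.sum_congr rfl fun j _ => by ring
      have h3 := (mul_eq_zero.1 h2).resolve_left (hne _)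
      simp_rw [mul_assoc]
      rw [← Finset.mul_sum, h3, mul_zero]
  · rintro ⟨c, p, h⟩
    refine ⟨fun j => ((Finsupp.equivFunOnFinite.symm a).multinomial : K)⁻¹ * c j,
      fun j => ∑ i, p j i • X i, fun j => ?_, ?_⟩
    · exact IsHomogeneous.sum _ _ _ fun i _ => by
        rw [smul_eq_C_mul]; simpa using (isHomogeneous_C_mul_X (p j i) i)
    · ext β
      simp only [coeff_monomial, coeff_sum, coeff_C_mul, coeff_pow_linearForm]
      by_cases hβ : ∑ i, β i = d
      · simp only [hβ, if_true]
        have h1 := h β hβ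
        have h2 : ∑ j, ((Finsupp.equivFunOnFinite.symm a).multinomial : K)⁻¹ * c j *
            (β.multinomial * ∏ i, p j i ^ β i) =
            ((Finsupp.equivFunOnFinite.symm a).multinomial : K)⁻¹ * β.multinomial *
              Set.indicator {a} 1 (β : σ → ℕ) := by
          rw [← h1, Finset.mul_sum]
          exact Finset.sum_congr rfl fun j _ => by ring
        rw [h2]
        by_cases hab : Finsupp.equivFunOnFinite.symm a = β
        · subst hab
          simp [hne]
        · rw [if_neg hab, Set.indicator_of_notMem, mul_zero]
          intro h'
          exact hab (by ext i; simp [← Set.mem_singleton_iff.1 h'])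
      · simp only [hβ, if_false, mul_zero, Finset.sum_const_zero]
        rw [if_neg]
        rintro rfl
        exact hβ (by simp [hd])

/-! ### Independence on the nodes and the trace argument -/

namespace ComputesCoeff

variable {K ι τ : Type*} [Field K] [Fintype ι] [Fintype τ] [DecidableEq τ] {c : ι → K} {q : ι → τ → K}
  {a : τ → ℕ} {D : ℕ}

/-- Leading-term argument: if m has maximal degree among the surviving exponents, multiplying by
x^(a-m) and applying the rule isolates N m. With t = 0 and u = 0 it gives independence; with general
t it bounds the degree of an expansion of u. -/
theorem coeff_eq_zero (h : ComputesCoeff c q a D) (ha : ∑ i, a i ≤ D)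
    (N : (∀ i, Fin (a i + 1)) → K) (u : ι → K)
    (hN : ∀ j, ∑ b, N b * ∏ i, q j i ^ (b i : ℕ) = u j) (t : ℕ)
    (hu : ∀ b : ∀ i, Fin (a i + 1), t ≤ ∑ i, (b i : ℕ) →
      ∑ j, c j * (u j * ∏ i, q j i ^ (a i - (b i : ℕ))) = 0)
    (b : ∀ i, Fin (a i + 1)) (hb : t ≤ ∑ i, (b i : ℕ)) : N b = 0 := by
  classical
  by_contra hNb
  obtain ⟨m, hm, hmax⟩ := Finset.exists_max_image
    ({b | t ≤ ∑ i, (b i : ℕ) ∧ N b ≠ 0} : Finset (∀ i, Fin (a i + 1)))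
    (fun b => ∑ i, (b i : ℕ)) ⟨b, by simp [hb, hNb]⟩
  simp only [Finset.mem_filter, Finset.mem_univ, true_and] at hm hmax
  apply hm.2
  have key : ∀ b, N b * ∑ j, c j * ∏ i, q j i ^ ((b i : ℕ) + (a i - (m i : ℕ))) =
      if b = m then N b else 0 := by
    intro b
    by_cases hb0 : N b = 0
    · simp [hb0]
    have hle : ∑ i, (b i : ℕ) ≤ ∑ i, (m i : ℕ) := by
      by_cases hbt : t ≤ ∑ i, (b i : ℕ)
      · exact hmax b ⟨hbt, hb0⟩
      · omega
    have hsum : ∑ i, (a i - (m i : ℕ)) + ∑ i, (m i : ℕ) = ∑ i, a i := by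
      rw [← Finset.sum_add_distrib]
      exact Finset.sum_congr rfl fun i _ => Nat.sub_add_cancel (Nat.lt_succ_iff.1 (m i).2)
    rw [h _ (by rw [Finset.sum_add_distrib]; omega)]
    by_cases hbm : b = m
    · subst hbm
      rw [if_pos rfl, Set.indicator_of_mem]
      · simp
      · ext i
        have := (b i).2
        omega
    · rw [if_neg hbm, Set.indicator_of_notMem, mul_zero]
      intro h'
      apply hbm
      funext i
      have h1 := congrFun (Set.mem_singleton_iff.1 h') i
      have := (m i).2
      ext
      omega
  calc N m = ∑ b, N b * ∑ j, c j * ∏ i, q j i ^ ((b i : ℕ) + (a i - (m i : ℕ))) := by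
        simp [key]
    _ = ∑ j, c j * ((∑ b, N b * ∏ i, q j i ^ (b i : ℕ)) * ∏ i, q j i ^ (a i - (m i : ℕ))) := by
        simp only [Finset.mul_sum, Finset.sum_mul]
        rw [Finset.sum_comm]
        refine Finset.sum_congr rfl fun j _ => Finset.sum_congr rfl fun b _ => ?_
        simp only [pow_add, Finset.prod_mul_distrib]
        ring
    _ = 0 := by
        simp only [hN]
        exact hu m hm.1

theorem linearIndependent (h : ComputesCoeff c q a D) (ha : ∑ i, a i ≤ D) :
    LinearIndependent K fun (b : ∀ i, Fin (a i + 1)) (j : ι) => ∏ i, q j i ^ (b i : ℕ) := by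
  rw [Fintype.linearIndependent_iff]
  intro g hg b
  refine h.coeff_eq_zero ha g 0 (fun j => ?_) 0 (by simp) b (Nat.zero_le _)
  simpa using congrFun hg j

theorem prod_le_card (h : ComputesCoeff c q a D) (ha : ∑ i, a i ≤ D) :
    ∏ i, (a i + 1) ≤ Fintype.card ι := by
  simpa using (h.linearIndependent ha).fintype_card_le_finrank

/-- The sum is the trace of multiplication by x_k^2, diagonal on point indicators; it is recomputed
in the monomial basis. -/
theorem sum_sq_eq_zero (h : ComputesCoeff c q a D) (ha : ∑ i, a i + 2 ≤ D)
    (hcard : Fintype.card ι = ∏ i, (a i + 1)) (k : τ) : ∑ j, q j k ^ 2 = 0 := by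
  classical
  have hli := h.linearIndependent (by omega)
  have : Nonempty (∀ i, Fin (a i + 1)) := ⟨fun _ => 0⟩
  let B := basisOfLinearIndependentOfCardEqFinrank hli (by simp [hcard])
  have hB (b) : B b = fun j => ∏ i, q j i ^ (b i : ℕ) := by
    simp [B]
  let w : ι → K := fun j => q j k ^ 2
  let f : (ι → K) →ₗ[K] (ι → K) := LinearMap.mulLeft K w
  have h1 : LinearMap.trace K _ f = ∑ j, q j k ^ 2 := by
    rw [LinearMap.trace_eq_matrix_trace K (Pi.basisFun K ι)]
    simp [Matrix.trace, f, w]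
  rw [← h1, LinearMap.trace_eq_matrix_trace K B]
  refine Finset.sum_eq_zero fun b _ => ?_
  rw [Matrix.diag_apply, LinearMap.toMatrix_apply]
  have hmul (j : ι) (β : τ → ℕ) :
      q j k ^ 2 * ∏ i, q j i ^ β i = ∏ i, q j i ^ (β i + (Pi.single k 2 : τ → ℕ) i) := by
    simp only [pow_add, Finset.prod_mul_distrib]
    rw [mul_comm]
    congr 1
    rw [Finset.prod_eq_single k]
    · simp
    · intro i _ hi
      simp [hi]
    · simp
  -- Either x_k^2 x^b is another basis monomial, or its expansion has only terms of degree below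
  -- that of b.
  by_cases hbk : (b k : ℕ) + 2 ≤ a k
  · let b' : ∀ i, Fin (a i + 1) := Function.update b k ⟨b k + 2, by omega⟩
    have hfb : f (B b) = B b' := by
      rw [hB, hB]
      funext j
      simp only [f, w, LinearMap.mulLeft_apply, Pi.mul_apply]
      rw [hmul]
      refine Finset.prod_congr rfl fun i _ => ?_
      by_cases hi : i = k
      · subst hi; simp [b']
      · simp [b', hi]
    have hne : b' ≠ b := fun e => by
      have := congrArg Fin.val (congrFun e k)
      simp [b'] at this
    rw [hfb, B.repr_self, Finsupp.single_eq_of_ne' hne]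
  · refine h.coeff_eq_zero (by omega) (fun b' => B.repr (f (B b)) b') (f (B b)) (fun j => ?_)
      (∑ i, (b i : ℕ)) (fun b' hb' => ?_) b le_rfl
    · have := congrFun (B.sum_repr (f (B b))) j
      simpa [hB] using this
    · have hsum : ∑ i, (a i - (b' i : ℕ)) + ∑ i, (b' i : ℕ) = ∑ i, a i := by
        rw [← Finset.sum_add_distrib]
        exact Finset.sum_congr rfl fun i _ => Nat.sub_add_cancel (Nat.lt_succ_iff.1 (b' i).2)
      have := h (fun i => (b i : ℕ) + (a i - (b' i : ℕ)) + (Pi.single k 2 : τ → ℕ) i) (by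
        simp only [Finset.sum_add_distrib]
        rw [Finset.sum_pi_single']
        simp only [Finset.mem_univ, if_true]
        omega)
      rw [Set.indicator_of_notMem] at this
      · rw [← this]
        refine Finset.sum_congr rfl fun j _ => ?_
        rw [← hmul]
        simp only [hB, f, w, LinearMap.mulLeft_apply, Pi.mul_apply, pow_add,
          Finset.prod_mul_distrib]
        ring
      -- The exponent at k is at least b k + 2, which exceeds a k.
      · intro h'
        have h1 := congrFun (Set.mem_singleton_iff.1 h') k
        have := (b' k).2
        simp only [Pi.single_eq_same] at h1
        omega

theorem prod_ne_card_of_real {c : ι → ℝ} {q : ι → τ → ℝ} (h : ComputesCoeff c q a D)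
    (ha : ∑ i, a i + 2 ≤ D) (k : τ) (hk : 0 < a k) : Fintype.card ι ≠ ∏ i, (a i + 1) := by
  classical
  intro hcard
  have h0 := h.sum_sq_eq_zero ha hcard k
  rw [Finset.sum_eq_zero_iff_of_nonneg fun j _ => sq_nonneg _] at h0
  refine (h.linearIndependent (by omega)).ne_zero
    (fun i => if hi : i = k then ⟨1, by subst hi; omega⟩ else 0) ?_
  funext j
  refine Finset.prod_eq_zero (Finset.mem_univ k) ?_
  simpa using h0 j (Finset.mem_univ j)

end ComputesCoeff

theorem computesCoeff_dehomogenize {K ι : Type*} [Field K] [Fintype ι] {n d D : ℕ}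
    {a : Fin (n + 1) → ℕ} (hd : d = ∑ i, a i) (hD : D ≤ d) {c : ι → K} {p : ι → Fin (n + 1) → K}
    (hp : ∀ j, p j 0 ≠ 0)
    (h : ∀ β : Fin (n + 1) → ℕ, ∑ i, β i = d → d - D ≤ β 0 →
      ∑ j, c j * ∏ i, p j i ^ β i = Set.indicator {a} 1 β) :
    ComputesCoeff (fun j => c j * p j 0 ^ d) (fun j i => p j (Fin.succ i) / p j 0)
      (fun i : Fin n => a i.succ) D := by
  intro β hβ
  have h1 := h (Fin.cons (d - ∑ i, β i) β) (by simp [Fin.sum_univ_succ]; omega)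
    (by simp; omega)
  have h2 : Set.indicator {a} (1 : (Fin (n + 1) → ℕ) → K) (Fin.cons (d - ∑ i, β i) β) =
      Set.indicator {fun i : Fin n => a i.succ} 1 β := by
    by_cases hβa : β = fun i : Fin n => a i.succ
    · rw [Set.indicator_of_mem, Set.indicator_of_mem]
      · rfl
      · exact hβa
      · rw [Set.mem_singleton_iff]
        funext i
        refine Fin.cases ?_ (fun i => ?_) i
        · rw [Fin.cons_zero, hd, Fin.sum_univ_succ, hβa, Nat.add_sub_cancel]
        · rw [Fin.cons_succ, hβa]
    · rw [Set.indicator_of_notMem, Set.indicator_of_notMem]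
      · exact hβa
      · intro h'
        apply hβa
        funext i
        simpa using congrFun (Set.mem_singleton_iff.1 h') i.succ
  rw [← h2, ← h1]
  refine Finset.sum_congr rfl fun j _ => ?_
  simp only [Fin.prod_univ_succ, Fin.cons_zero, Fin.cons_succ, div_pow, Finset.prod_div_distrib,
    Finset.prod_pow_eq_pow_sum]
  have hs : p j 0 ^ d = p j 0 ^ (d - ∑ i, β i) * p j 0 ^ (∑ i, β i) := by
    rw [← pow_add]; congr 1; omega
  have := pow_ne_zero (∑ i, β i) (hp j)
  rw [hs]
  field_simp

/-! ### Bounds on the number of summands -/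

section Bounds

variable {n d : ℕ} {a : Fin (n + 1) → ℕ}

theorem prod_le_card_nonzero {K : Type*} [Field K] (ha0 : 0 < a 0) (hd : d = ∑ i, a i) {s : ℕ}
    {c : Fin s → K} {p : Fin s → Fin (n + 1) → K}
    (h : ∀ β : Fin (n + 1) → ℕ, ∑ i, β i = d →
      ∑ j, c j * ∏ i, p j i ^ β i = Set.indicator {a} 1 β) :
    ∏ i : Fin n, (a i.succ + 1) ≤ Nat.card {j // p j 0 ≠ 0} := by
  classical
  have hd' := hd
  rw [Fin.sum_univ_succ] at hd'
  rw [Nat.card_eq_fintype_card]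
  -- Degree d - 1 forces β 0 ≥ 1, so nodes with x_0 = 0 contribute nothing.
  refine (computesCoeff_dehomogenize (ι := {j // p j 0 ≠ 0}) (c := fun j => c j)
    (p := fun j => p j) hd (Nat.sub_le d 1) (fun j => j.2) fun β hβ hβ0 => ?_).prod_le_card
    (by omega)
  rw [← h β hβ, ← Finset.sum_subtype (Finset.univ.filter fun j => p j 0 ≠ 0) (by simp)
    fun j => c j * ∏ i, p j i ^ β i, Finset.sum_filter_of_ne]
  intro j _ hj hj0
  refine hj (mul_eq_zero_of_right _ (Finset.prod_eq_zero (Finset.mem_univ 0) ?_))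
  rw [hj0, zero_pow (by omega)]

theorem prod_le_of_hasWaringDecomposition {K : Type*} [Field K] [CharZero K] (ha0 : 0 < a 0)
    (hd : d = ∑ i, a i) {s : ℕ}
    (h : HasWaringDecomposition K d (∏ i, (X i : MvPolynomial (Fin (n + 1)) K) ^ a i) s) :
    ∏ i : Fin n, (a i.succ + 1) ≤ s := by
  obtain ⟨c, p, h⟩ := (hasWaringDecomposition_monomial_iff a d hd s).1 h
  refine (prod_le_card_nonzero ha0 hd h).trans ?_
  simpa using Nat.card_le_card_of_injective _ (Subtype.val_injective (p := fun j => p j 0 ≠ 0))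

theorem not_hasWaringDecomposition_real (hn : 1 ≤ n) (ha0 : 2 ≤ a 0) (ha : Monotone a)
    (hd : d = ∑ i, a i) :
    ¬ HasWaringDecomposition ℝ d (∏ i, (X i : MvPolynomial (Fin (n + 1)) ℝ) ^ a i)
      (∏ i : Fin n, (a i.succ + 1)) := by
  intro h
  classical
  obtain ⟨c, p, h⟩ := (hasWaringDecomposition_monomial_iff a d hd _).1 h
  have hle := prod_le_card_nonzero (by omega) hd h
  -- At the minimal count no node lies on x_0 = 0, so the affine rule is exact up to degree d, not
  -- just d - 1.
  have hp : ∀ j, p j 0 ≠ 0 := by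
    by_contra! hj
    obtain ⟨j, hj⟩ := hj
    have := Fintype.card_subtype_lt (p := fun j => p j 0 ≠ 0) (x := j) (by simpa using hj)
    rw [Nat.card_eq_fintype_card] at hle
    simp only [Fintype.card_fin] at this
    omega
  have hd' := hd
  rw [Fin.sum_univ_succ] at hd'
  have h1 := ha (Fin.zero_le (Fin.succ ⟨0, hn⟩))
  exact (computesCoeff_dehomogenize hd le_rfl hp fun β hβ _ => h β hβ).prod_ne_card_of_real
    (by omega) ⟨0, hn⟩ (by omega) (by simp)

/-- A product of univariate quadrature rules gives a Waring decomposition. -/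
theorem hasWaringDecomposition_of_univariate {K : Type*} [Field K] [CharZero K]
    (hd : d = ∑ i, a i)
    (h : ∀ i : Fin n, ∃ (w t : Fin (a i.succ + 1) → K), ∀ m ≤ a i.succ + a 0,
      ∑ k, w k * t k ^ m = if m = a i.succ then 1 else 0) :
    HasWaringDecomposition K d (∏ i, (X i : MvPolynomial (Fin (n + 1)) K) ^ a i)
      (∏ i : Fin n, (a i.succ + 1)) := by
  classical
  choose w t hwt using h
  rw [hasWaringDecomposition_monomial_iff a d hd]
  let e : Fin (∏ i : Fin n, (a i.succ + 1)) ≃ (∀ i : Fin n, Fin (a i.succ + 1)) :=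
    Fintype.equivOfCardEq (by simp)
  refine ⟨fun j => ∏ i, w i (e j i), fun j => Fin.cons 1 fun i => t i (e j i), fun β hβ => ?_⟩
  have h1 : ∑ j, (∏ i, w i (e j i)) *
      ∏ i, (Fin.cons 1 (fun i => t i (e j i)) : Fin (n + 1) → K) i ^ β i =
      ∏ i : Fin n, ∑ k, w i k * t i k ^ β i.succ := by
    rw [Finset.prod_univ_sum, Fintype.piFinset_univ, ← e.sum_comp]
    refine Finset.sum_congr rfl fun j _ => ?_
    simp [Fin.prod_univ_succ, Finset.prod_mul_distrib]
  rw [h1]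
  rw [Fin.sum_univ_succ] at hβ hd
  by_cases hβa : β = a
  · subst hβa
    simp [hwt]
  rw [Set.indicator_of_notMem (by simpa using hβa)]
  by_cases hlow : ∃ i : Fin n, β i.succ < a i.succ
  · obtain ⟨i, hi⟩ := hlow
    exact Finset.prod_eq_zero (Finset.mem_univ i) (by rw [hwt i _ (by omega), if_neg hi.ne])
  push Not at hlow
  -- With no exponent below its target, the total excess over `a` in the last n variables is at most
  -- a 0, so the univariate rules apply.
  have hle (i : Fin n) : β i.succ ≤ a i.succ + a 0 := by
    have := Finset.add_sum_erase Finset.univ (fun i : Fin n => β i.succ) (Finset.mem_univ i)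
    have := Finset.add_sum_erase Finset.univ (fun i : Fin n => a i.succ) (Finset.mem_univ i)
    have := Finset.sum_le_sum (s := Finset.univ.erase i) fun i _ => hlow i
    omega
  have hex : ∃ i : Fin n, β i.succ ≠ a i.succ := by
    by_contra! hall
    simp only [hall] at hβ
    exact hβa (funext fun i => Fin.cases (by omega) hall i)
  obtain ⟨i, hi⟩ := hex
  exact Finset.prod_eq_zero (Finset.mem_univ i) (by rw [hwt i _ (hle i), if_neg hi])

end Bounds

/-! ### Univariate rules from Lagrange interpolation -/

theorem exists_weights_sum_mul_pow {K : Type*} [Field K] {m : ℕ} {t : Fin (m + 1) → K}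
    (ht : Function.Injective t) :
    ∃ w : Fin (m + 1) → K, ∀ P : Polynomial K, P.degree < (m + 1 : ℕ) →
      ∑ k, w k * P.eval (t k) = P.coeff m := by
  classical
  refine ⟨fun k => (∏ j ∈ Finset.univ.erase k, (t k - t j))⁻¹, fun P hP => ?_⟩
  have := Lagrange.coeff_eq_sum (s := Finset.univ) (v := t) ht.injOn (P := P) (by simpa using hP)
  simp only [Finset.card_univ, Fintype.card_fin, Nat.add_sub_cancel] at this
  rw [this]
  exact Finset.sum_congr rfl fun k _ => by rw [div_eq_inv_mul]

/-- At the (m+1)-th roots of unity x^(m+1+l') equals x^l', and l' < r ≤ m makes its coefficient at m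
zero. -/
theorem exists_weights_complex {m r : ℕ} (hr : r ≤ m) :
    ∃ w t : Fin (m + 1) → ℂ, ∀ l ≤ m + r, ∑ k, w k * t k ^ l = if l = m then 1 else 0 := by
  have hζ := Complex.isPrimitiveRoot_exp (m + 1) (by omega)
  set ζ := Complex.exp (2 * Real.pi * Complex.I / (m + 1 : ℕ))
  obtain ⟨w, hw⟩ := exists_weights_sum_mul_pow (t := fun k : Fin (m + 1) => ζ ^ (k : ℕ))
    fun i j hij => Fin.ext (hζ.pow_inj i.2 j.2 hij)
  have hw' (l : ℕ) (hl : l ≤ m) :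
      ∑ k, w k * (ζ ^ (k : ℕ)) ^ l = if l = m then 1 else 0 := by
    have := hw (Polynomial.X ^ l) (by
      rw [Polynomial.degree_X_pow]; exact_mod_cast Nat.lt_succ_of_le hl)
    simpa [Polynomial.coeff_X_pow, eq_comm] using this
  refine ⟨w, fun k => ζ ^ (k : ℕ), fun l hl => ?_⟩
  by_cases hlm : l ≤ m
  · exact hw' l hlm
  · obtain ⟨l', rfl⟩ := Nat.exists_eq_add_of_lt (not_le.1 hlm)
    have h0 := hw' l' (by omega)
    rw [if_neg (by omega)] at h0
    rw [if_neg (by omega), ← h0]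
    refine Finset.sum_congr rfl fun k _ => ?_
    rw [show m + l' + 1 = (m + 1) + l' by ring, pow_add (ζ ^ (k : ℕ)), pow_right_comm,
      hζ.pow_eq_one, one_pow, one_mul]

theorem exists_weights_real (m : ℕ) :
    ∃ w t : Fin (m + 1) → ℝ, ∀ l ≤ m + 1, ∑ k, w k * t k ^ l = if l = m then 1 else 0 := by
  classical
  -- Any distinct nodes with sum zero would do.
  let t : Fin (m + 1) → ℝ := fun k => 2 * (k : ℕ) - m
  have ht : Function.Injective t := fun i j hij => by
    have : ((i : ℕ) : ℝ) = (j : ℕ) := by simp only [t] at hij; linarith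
    exact Fin.ext (by exact_mod_cast this)
  have hsum : ∑ k, t k = 0 := by
    have h1 : ∑ k, t (Fin.rev k) = ∑ k, t k := Equiv.sum_comp Fin.revPerm t
    have h2 : ∀ k, t (Fin.rev k) = - t k := fun k => by
      have : ((Fin.rev k : ℕ) : ℝ) = m - (k : ℕ) := by
        rw [Fin.val_rev, Nat.cast_sub (by omega)]; push_cast; ring
      simp only [t, this]; ring
    simp only [h2, Finset.sum_neg_distrib] at h1
    linarith
  obtain ⟨w, hw⟩ := exists_weights_sum_mul_pow ht
  refine ⟨w, t, fun l hl => ?_⟩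
  rcases Nat.lt_or_eq_of_le hl with hl | rfl
  · have := hw (Polynomial.X ^ l) (by
      rw [Polynomial.degree_X_pow]; exact_mod_cast hl)
    simpa [Polynomial.coeff_X_pow, eq_comm] using this
  · rw [if_neg (by omega)]
    -- On the nodes X^(m+1) agrees with X^(m+1) - Q, whose coefficient at m is the sum of the nodes,
    -- namely 0.
    let Q : Polynomial ℝ := ∏ k, (Polynomial.X - Polynomial.C (t k))
    have hQm : Q.Monic := Polynomial.monic_prod_of_monic _ _ fun k _ => Polynomial.monic_X_sub_C _
    have hQd : Q.degree = (m + 1 : ℕ) := by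
      simp [Q, Polynomial.degree_prod]
    have hQn : Q.natDegree = m + 1 := Polynomial.natDegree_eq_of_degree_eq_some hQd
    have hQc : Q.coeff m = 0 := by
      have h1 : Q.nextCoeff = -∑ k, t k := Polynomial.prod_X_sub_C_nextCoeff t
      rw [Polynomial.nextCoeff_of_natDegree_pos (by omega), hQn, hsum, neg_zero] at h1
      exact h1
    have hlt : (Polynomial.X ^ (m + 1) - Q).degree < ((m + 1 : ℕ) : WithBot ℕ) := by
      have := Polynomial.degree_sub_lt_left (p := Polynomial.X ^ (m + 1)) (q := Q)
        (by rw [Polynomial.degree_X_pow, hQd]) (pow_ne_zero _ Polynomial.X_ne_zero)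
        (by rw [hQm.leadingCoeff, Polynomial.leadingCoeff_X_pow])
      rwa [Polynomial.degree_X_pow] at this
    have h2 := hw _ hlt
    have hQe (k) : Q.eval (t k) = 0 := by
      rw [Polynomial.eval_prod]
      exact Finset.prod_eq_zero (Finset.mem_univ k) (by simp)
    simpa [hQe, hQc, Polynomial.coeff_X_pow] using h2

/-! ### Passage to ranks and conclusion -/

theorem waringRank_le {K : Type*} [Field K] {σ : Type*} {d s : ℕ} {F : MvPolynomial σ K}
    (h : HasWaringDecomposition K d F s) : waringRank K d F ≤ s :=
  iInf₂_le s h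

theorem le_waringRank_monomial {K : Type*} [Field K] [CharZero K] {n d : ℕ} {a : Fin (n + 1) → ℕ}
    (ha0 : 0 < a 0) (hd : d = ∑ i, a i) :
    ((∏ i : Fin n, (a i.succ + 1) : ℕ) : ℕ∞) ≤
      waringRank K d (∏ i, (X i : MvPolynomial (Fin (n + 1)) K) ^ a i) :=
  le_iInf₂ fun _ h => by exact_mod_cast prod_le_of_hasWaringDecomposition ha0 hd h

theorem hasWaringDecomposition_of_waringRank_eq {K : Type*} [Field K] {σ : Type*} {d s : ℕ}
    {F : MvPolynomial σ K} (h : waringRank K d F = s) : HasWaringDecomposition K d F s := by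
  have hlt : waringRank K d F < (s + 1 : ℕ) := by
    rw [h]; exact_mod_cast Nat.lt_succ_self s
  simp only [waringRank, iInf_lt_iff] at hlt
  obtain ⟨r, hr, hrs⟩ := hlt
  have h1 : s ≤ r := by
    have := waringRank_le hr
    rw [h] at this
    exact_mod_cast this
  have h2 : r < s + 1 := by exact_mod_cast hrs
  obtain rfl : r = s := by omega
  exact hr

theorem theorem3p6 (n : ℕ) (hn : 1 ≤ n) (a : Fin (n + 1) → ℕ) (ha0 : 0 < a 0) (ha : Monotone a)
    (d : ℕ) (hd : d = ∑ i, a i) :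
    waringRank ℝ d (∏ i, (X i : MvPolynomial (Fin (n + 1)) ℝ) ^ a i) =
      waringRank ℂ d (∏ i, (X i : MvPolynomial (Fin (n + 1)) ℂ) ^ a i) ↔ a 0 = 1 := by
  have hC : waringRank ℂ d (∏ i, (X i : MvPolynomial (Fin (n + 1)) ℂ) ^ a i) =
      (∏ i : Fin n, (a i.succ + 1) : ℕ) :=
    le_antisymm (waringRank_le (hasWaringDecomposition_of_univariate hd fun i =>
      exists_weights_complex (ha (Fin.zero_le _)))) (le_waringRank_monomial ha0 hd)
  rw [hC]
  constructor
  · intro h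
    by_contra h1
    exact not_hasWaringDecomposition_real hn (by omega) ha hd
      (hasWaringDecomposition_of_waringRank_eq h)
  · intro h1
    exact le_antisymm (waringRank_le (hasWaringDecomposition_of_univariate hd fun i => by
      rw [h1]; exact exists_weights_real _)) (le_waringRank_monomial ha0 hd)
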